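/- Let $U_n$ be the set of upper-triangular $n\times n$ matrices with entries in $\mathbb{N}=\{0,1,2,\dots\}$. For $\mathbf{h}\in\mathbb{Z}^n$ let $\mathcal{T}(\mathbf{h})$ be the (finite) set of Tesler matrices with hook sum vector $\mathbf{h}$, that is, of all $A=(a_{ij})\in U_n$ such that $$\sum_{i=k}^{n}a_{ki}-\sum_{i=1}^{k-1}a_{ik}=h_k\qquad(1\le k\le n).$$ For positive integers $h,w$ put $$L[h,w]=\ln\bigl|\mathcal{T}(h,\mathbf{0}^{w-1})\bigr|,$$ where $(h,\mathbf{0}^{w-1})$ is the vector of length $w$ with first entry $h$ and all other entries $0$. The number $|\mathcal{T}(h,\mathbf{0}^{w-1})|$ is also the number of Kostant pictures of constant height $h$ on $w$ vertices, that is, of families $(c_{ij})_{1\le i\le j\le w}$ in $\mathbb{N}$ with $\sum_{i\le j}c_{ij}\,(e_i-e_{j+1})=\sum_{i=1}^{w}h\,(e_i-e_{i+1})$, where $e_1,\dots,e_{w+1}$ is the standard basis of $\mathbb{R}^{w+1}$. **Theorem.** Let $h,w:\mathbb{Z}^+\to\mathbb{Z}^+$ be functions with $h(n)\to\infty$ and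 $w(n)\to\infty$ as $n\to\infty$. Write $f\sim g$ for $f(n)/g(n)\to1$ and $f\prec g$ (equivalently $g\succ f$) for $f(n)/g(n)\to0$ as $n\to\infty$. 1. If $w\prec\sqrt{h}$, then $L[h,w]\sim w^2\ln\left(\dfrac{\sqrt{h}}{w}\right)$. 2. There is a universal constant $\gamma_+>0$, independent of the functions $h$ and $w$, such that $L[h,w]\sim\gamma_+\,w\sqrt{h}$ whenever $w\succ\sqrt{h}$. -/

import Mathlib

open Filter Asymptotics

namespace Tesler

/-- `U_n`: the `n × n` upper-triangular matrices with non-negative integer entries. -/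
def upperTriangular (n : ℕ) : Set (Matrix (Fin n) (Fin n) ℕ) :=
  {A | ∀ i j, j < i → A i j = 0}

/-- The `k`-th hook sum of `A`: the sum of the entries `A k i` with `i ≥ k`, minus the sum of
the entries `A i k` with `i < k`. -/
def hookSum {n : ℕ} (A : Matrix (Fin n) (Fin n) ℕ) (k : Fin n) : ℤ :=
  ∑ i ∈ Finset.Ici k, (A k i : ℤ) - ∑ i ∈ Finset.Iio k, (A i k : ℤ)

/-- The set `T(η)` of (generalized) Tesler matrices with hook sum vector `η`. -/
def teslerMatrices {n : ℕ} (η : Fin n → ℤ) : Set (Matrix (Fin n) (Fin n) ℕ) :=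
  {A | A ∈ upperTriangular n ∧ ∀ k, hookSum A k = η k}

/-- There are finitely many Tesler matrices with a given hook sum vector, so that counting them
with `Set.ncard` is meaningful. -/
theorem finite_teslerMatrices {n : ℕ} (η : Fin n → ℤ) : (teslerMatrices η).Finite := by
  have key : ∀ m : ℕ, ∃ B : ℕ, ∀ A ∈ teslerMatrices η, ∀ k : Fin n, k.val < m →
      ∀ j, A k j ≤ B := by
    intro m
    induction m with
    | zero => exact ⟨0, fun A _ k hk => absurd hk (Nat.not_lt_zero _)⟩
    | succ m ih =>
      obtain ⟨B, hB⟩ := ih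
      by_cases hm : m < n
      · refine ⟨B + ((η ⟨m, hm⟩).natAbs + n * B), fun A hA k hk j => ?_⟩
        rcases Nat.lt_succ_iff_lt_or_eq.mp hk with h1 | h1
        · exact (hB A hA k h1 j).trans (Nat.le_add_right _ _)
        · have hkm : k = ⟨m, hm⟩ := Fin.ext h1
          by_cases hj : j < k
          · rw [hA.1 k j hj]
            exact Nat.zero_le _
          · have hs := hA.2 k
            have h2 : (A k j : ℤ) ≤ ∑ i ∈ Finset.Ici k, (A k i : ℤ) :=
              Finset.single_le_sum (f := fun i => (A k i : ℤ))
                (fun i _ => Int.natCast_nonneg _) (Finset.mem_Ici.mpr (not_lt.mp hj))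
            have h3 : ∑ i ∈ Finset.Iio k, (A i k : ℤ) ≤ n * B := by
              calc ∑ i ∈ Finset.Iio k, (A i k : ℤ) ≤ ∑ _i ∈ Finset.Iio k, (B : ℤ) := by
                    refine Finset.sum_le_sum fun i hi => ?_
                    have hi0 : i < k := Finset.mem_Iio.mp hi
                    have hi' : i.val < m := by
                      rw [← h1]
                      exact hi0
                    exact_mod_cast hB A hA i hi' k
                _ ≤ n * B := by
                    rw [Finset.sum_const, Fin.card_Iio, nsmul_eq_mul]
                    have : k.val ≤ n := k.isLt.le
                    gcongr
            unfold hookSum at hs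
            have h4 : η k ≤ ((η ⟨m, hm⟩).natAbs : ℤ) := by
              rw [hkm]
              exact Int.le_natAbs
            zify
            push_cast at h4
            linarith [Int.natCast_nonneg B]
      · exact ⟨B, fun A hA k _ j => hB A hA k (k.isLt.trans_le (not_lt.mp hm)) j⟩
  obtain ⟨B, hB⟩ := key n
  exact (Set.finite_Iic (α := Fin n → Fin n → ℕ) (fun _ _ => B)).subset
    fun A hA k j => hB A hA k k.isLt j

/-- The hook sum vector `(h, 0, …, 0)` of length `w`. -/
def firstHook (h w : ℕ) : Fin w → ℤ := fun k => if k.val = 0 then (h : ℤ) else 0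

/-- `L[h, w] = ln |T(h, 0, …, 0)|` with `w - 1` zeros. -/
noncomputable def L (h w : ℕ) : ℝ := Real.log (teslerMatrices (firstHook h w)).ncard

/-- The positive root `α_{ij} = e_i - e_{j+1}` in `ℤ^{n+1}`, for vertices `i ≤ j`. -/
def root {n : ℕ} (i j : Fin n) : Fin (n + 1) → ℤ :=
  Pi.single i.castSucc 1 - Pi.single j.succ 1

/-- The Kostant pictures for the weight `ν`. A picture on `n` ordered vertices is recorded by
the number `c i j` of loops around the vertices `i` through `j`, for `i ≤ j`. -/
def kostantPictures {n : ℕ} (ν : Fin (n + 1) → ℤ) : Set (Matrix (Fin n) (Fin n) ℕ) :=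
  {c | c ∈ upperTriangular n ∧ ∑ i, ∑ j ∈ Finset.Ici i, (c i j : ℤ) • root i j = ν}

/-- The Kostant pictures of height `η`, that is, for the weight `∑ i, η i • α_{ii}`. -/
def kostantPicturesOfHeight {n : ℕ} (η : Fin n → ℤ) : Set (Matrix (Fin n) (Fin n) ℕ) :=
  kostantPictures (∑ i, η i • root i i)

end Tesler

namespace Tesler

/-! Sliding the off-diagonal entries of a Tesler matrix one column to the left and moving the
diagonal to the last column turns it into a Kostant picture. Such a picture is a multiset of
intervals ("loops") covering every vertex exactly `h` times. One-vertex loops are slack variables,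
so what is counted is the set `packings h w` of multiplicities of longer loops that cover each
vertex at most `h` times.

Upper bound (`L_le`): adding the vertex constraints gives `∑ length * multiplicity ≤ w * h`.
Weighting each loop by `exp (-β * length)` and summing geometric series gives `L ≤ β w h - ∑ log (1
- exp (-β * length))` for every `β > 0`.

If `w ≺ √h`, take `β = w / h`. Each of the about `w² / 2` long loops contributes `log (h / w²) = 2
log (√h / w)`, with total error `O(w²)`. Conversely, all multiplicities up to `h / w²` may be chosen
independently.

If `w ≻ √h`, let `Z` be the supremum of `θ * loopEntropy θ T`. The upper bound becomes `β w h + w Z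
/ β`, which is `2 √Z w √h` at the optimal `β`. For the matching lower bound, cut the vertices into
blocks of size `s` proportional to `√h`. For blocks at distance `t + 1 ≤ T`, prescribe only a bound
on the total multiplicity of the `s²` loops joining them; binomial coefficients count the choices.
Taking these bounds to be `s²` times the mean of a geometric law with ratio `exp (-θ (t + 2))` gives
`w √h (θ √A + S / √A)` to leading order, where `S = loopEntropy θ T` and `A` is the load per vertex
divided by `s²`. By AM-GM this is at least `2 √(θ S) w √h`. -/

/-! ### Tesler matrices and Kostant pictures -/

theorem sum_smul_root {n : ℕ} (c : Matrix (Fin n) (Fin n) ℕ) :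
    ∑ i, ∑ j ∈ Finset.Ici i, (c i j : ℤ) • root i j =
      ∑ k, (∑ j ∈ Finset.Ici k, (c k j : ℤ)) • Pi.single k.castSucc (1 : ℤ) -
        ∑ k, (∑ i ∈ Finset.Iic k, (c i k : ℤ)) • Pi.single k.succ (1 : ℤ) := by
  simp only [root, smul_sub, Finset.sum_sub_distrib, Finset.sum_smul]
  congr 1
  exact Finset.sum_comm' (by simp)

theorem sum_smul_single_sub_apply_castSucc {n : ℕ} (R C : Fin n → ℤ) (k : Fin n) :
    (∑ i, R i • Pi.single i.castSucc (1 : ℤ) - ∑ i, C i • Pi.single i.succ (1 : ℤ) :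
      Fin (n + 1) → ℤ) k.castSucc = R k - ∑ i, if i.succ = k.castSucc then C i else 0 := by
  simp [Finset.sum_apply, Pi.single_apply, eq_comm]

theorem sum_smul_root_self {n : ℕ} (η : Fin n → ℤ) :
    ∑ i, η i • root i i =
      ∑ i, η i • Pi.single i.castSucc (1 : ℤ) - ∑ i, η i • Pi.single i.succ (1 : ℤ) := by
  simp only [root, smul_sub, Finset.sum_sub_distrib]

theorem sum_root_apply {n : ℕ} (i j : Fin n) : ∑ v, root i j v = 0 := by
  simp [root]

theorem sum_sum_smul_root_apply {n : ℕ} (c : Matrix (Fin n) (Fin n) ℕ) :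
    ∑ v, (∑ i, ∑ j ∈ Finset.Ici i, (c i j : ℤ) • root i j) v = 0 := by
  simp only [Finset.sum_apply, Pi.smul_apply]
  rw [Finset.sum_comm]
  refine Finset.sum_eq_zero fun i _ => ?_
  rw [Finset.sum_comm]
  simp only [← Finset.smul_sum, sum_root_apply, smul_zero, Finset.sum_const_zero]

theorem sum_sum_smul_root_self_apply {n : ℕ} (η : Fin n → ℤ) :
    ∑ v, (∑ i, η i • root i i) v = 0 := by
  simp only [Finset.sum_apply, Pi.smul_apply]
  rw [Finset.sum_comm]
  simp only [← Finset.smul_sum, sum_root_apply, smul_zero, Finset.sum_const_zero]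

theorem sum_Iic_root_apply {n : ℕ} {i j : Fin n} (hij : i ≤ j) (k : Fin n) :
    ∑ v ∈ Finset.Iic k.castSucc, root i j v = if i ≤ k ∧ k ≤ j then 1 else 0 := by
  simp only [root, Pi.sub_apply, Finset.sum_sub_distrib, Pi.single_apply, Finset.sum_ite_eq',
    Finset.mem_Iic, Fin.castSucc_le_castSucc_iff, Fin.succ_le_castSucc_iff]
  by_cases h1 : i ≤ k <;> by_cases h2 : k ≤ j <;> simp [h1, h2] <;> grind

/-- An integer vector is determined by its partial sums. -/
theorem eq_of_sum_Iic_eq {n : ℕ} {f g : Fin n → ℤ}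
    (H : ∀ k, ∑ v ∈ Finset.Iic k, f v = ∑ v ∈ Finset.Iic k, g v) : f = g := by
  funext k
  induction k using WellFoundedLT.induction with
  | ind k ih =>
    have hk := H k
    rw [← Finset.Iio_insert, Finset.sum_insert (by simp), Finset.sum_insert (by simp),
      Finset.sum_congr rfl fun v hv => ih v (Finset.mem_Iio.mp hv)] at hk
    exact add_right_cancel hk

/-- The number of loops of `c` that enclose the vertex `k`. -/
def coverage {n : ℕ} (c : Matrix (Fin n) (Fin n) ℕ) (k : Fin n) : ℕ :=
  ∑ i ∈ Finset.Iic k, ∑ j ∈ Finset.Ici k, c i j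

theorem sum_Iic_sum_smul_root {n : ℕ} (c : Matrix (Fin n) (Fin n) ℕ) (k : Fin n) :
    ∑ v ∈ Finset.Iic k.castSucc, (∑ i, ∑ j ∈ Finset.Ici i, (c i j : ℤ) • root i j) v =
      coverage c k := by
  simp only [Finset.sum_apply, Pi.smul_apply]
  rw [Finset.sum_comm]
  have : ∀ i, ∑ v ∈ Finset.Iic k.castSucc, ∑ j ∈ Finset.Ici i, (c i j : ℤ) • root i j v =
      if i ≤ k then ∑ j ∈ Finset.Ici k, (c i j : ℤ) else 0 := by
    intro i
    rw [Finset.sum_comm]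
    simp only [← Finset.smul_sum]
    rw [Finset.sum_congr rfl fun j hj => by rw [sum_Iic_root_apply (Finset.mem_Ici.mp hj) k]]
    split_ifs with hik
    · simp only [hik, true_and, smul_eq_mul, mul_ite, mul_one, mul_zero, ← Finset.sum_filter]
      congr 1
      ext j
      simp only [Finset.mem_filter, Finset.mem_Ici]
      exact ⟨fun h => h.2, fun h => ⟨hik.trans h, h⟩⟩
    · simp [hik]
  simp only [this, coverage, Nat.cast_sum, ← Finset.sum_filter]
  congr 1
  ext i
  simp

theorem sum_Iic_sum_smul_root_self {n : ℕ} (η : Fin n → ℤ) (k : Fin n) :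
    ∑ v ∈ Finset.Iic k.castSucc, (∑ i, η i • root i i) v = η k := by
  simp only [Finset.sum_apply, Pi.smul_apply]
  rw [Finset.sum_comm]
  simp only [← Finset.smul_sum, sum_Iic_root_apply le_rfl]
  rw [Finset.sum_eq_single k] <;> simp
  intro b hb h1 h2
  exact absurd (le_antisymm h1 h2) hb

/-- Take partial sums of coordinates: those of `root i j` form the indicator of the interval from
`i` to `j`. The full sum carries no information, since every root has coordinate sum zero. -/
theorem mem_kostantPicturesOfHeight_iff_coverage {n : ℕ} {η : Fin n → ℤ}
    {c : Matrix (Fin n) (Fin n) ℕ} :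
    c ∈ kostantPicturesOfHeight η ↔ c ∈ upperTriangular n ∧ ∀ k, (coverage c k : ℤ) = η k := by
  refine and_congr_right fun _ => ⟨fun h k => ?_, fun h => eq_of_sum_Iic_eq fun k => ?_⟩
  · rw [← sum_Iic_sum_smul_root, h, sum_Iic_sum_smul_root_self]
  · cases k using Fin.lastCases with
    | last =>
      rw [show Finset.Iic (Fin.last n) = Finset.univ by ext; simp [Fin.le_last],
        sum_sum_smul_root_apply, sum_sum_smul_root_self_apply]
    | cast k => rw [sum_Iic_sum_smul_root, sum_Iic_sum_smul_root_self, h k]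

/-- This is the weight equation read coordinate by coordinate. The last coordinate can be dropped
because all coordinates of a root add up to zero. -/
theorem mem_kostantPicturesOfHeight_iff_rows {n : ℕ} {η : Fin n → ℤ}
    {c : Matrix (Fin n) (Fin n) ℕ} :
    c ∈ kostantPicturesOfHeight η ↔ c ∈ upperTriangular n ∧
      ∀ k : Fin n, ∑ j ∈ Finset.Ici k, (c k j : ℤ) -
          (∑ m : Fin n, if m.succ = k.castSucc then ∑ i ∈ Finset.Iic m, (c i m : ℤ) else 0) =
        η k - ∑ m : Fin n, if m.succ = k.castSucc then η m else 0 := by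
  have key : ∀ k : Fin n, _ := fun k => sum_smul_single_sub_apply_castSucc
    (fun k => ∑ j ∈ Finset.Ici k, (c k j : ℤ)) (fun k => ∑ i ∈ Finset.Iic k, (c i k : ℤ)) k
  have key' := fun k => sum_smul_single_sub_apply_castSucc η η k
  simp only [← sum_smul_root, ← sum_smul_root_self] at key key'
  refine and_congr_right fun _ => ⟨fun h k => ?_, fun h => ?_⟩
  · rw [← key, ← key', h]
  · refine eq_of_sum_Iic_eq fun k => ?_
    have hs : ∀ k : Fin n, (∑ i, ∑ j ∈ Finset.Ici i, (c i j : ℤ) • root i j) k.castSucc =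
        (∑ i, η i • root i i) k.castSucc := fun k => by rw [key, key', h]
    cases k using Fin.lastCases with
    | last =>
      rw [show Finset.Iic (Fin.last n) = Finset.univ by ext; simp [Fin.le_last],
        sum_sum_smul_root_apply, sum_sum_smul_root_self_apply]
    | cast k =>
      refine Finset.sum_congr rfl fun v hv => ?_
      obtain ⟨v, rfl⟩ := Fin.exists_castSucc_eq.mpr
        (ne_of_lt ((Finset.mem_Iic.mp hv).trans_lt (Fin.castSucc_lt_last k)))
      exact hs v

/-- The picture of a flow: the entry `A i (j + 1)` becomes the loops around `i, …, j`, and the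
diagonal entry `A i i` the loops around `i` and everything to its right. -/
def toPicture {n : ℕ} (A : Matrix (Fin (n + 1)) (Fin (n + 1)) ℕ) :
    Matrix (Fin (n + 1)) (Fin (n + 1)) ℕ := fun i j =>
  if i ≤ j then Fin.lastCases (motive := fun _ => ℕ) (A i i) (fun m => A i m.succ) j else 0

/-- The inverse of `toPicture`. -/
def ofPicture {n : ℕ} (c : Matrix (Fin (n + 1)) (Fin (n + 1)) ℕ) :
    Matrix (Fin (n + 1)) (Fin (n + 1)) ℕ := fun i j =>
  if i = j then c i (Fin.last n) else
    if i < j then Fin.cases (motive := fun _ => ℕ) 0 (fun m => c i m.castSucc) j else 0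

theorem toPicture_last {n : ℕ} (A : Matrix (Fin (n + 1)) (Fin (n + 1)) ℕ) (i : Fin (n + 1)) :
    toPicture A i (Fin.last n) = A i i := by
  simp [toPicture, Fin.le_last]

theorem toPicture_castSucc {n : ℕ} (A : Matrix (Fin (n + 1)) (Fin (n + 1)) ℕ)
    {i : Fin (n + 1)} {m : Fin n} (h : i ≤ m.castSucc) :
    toPicture A i m.castSucc = A i m.succ := by
  simp [toPicture, h]

theorem toPicture_mem {n : ℕ} (A : Matrix (Fin (n + 1)) (Fin (n + 1)) ℕ) :
    toPicture A ∈ upperTriangular (n + 1) := fun i j hij => by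
  simp [toPicture, not_le.mpr hij]

theorem ofPicture_mem {n : ℕ} (c : Matrix (Fin (n + 1)) (Fin (n + 1)) ℕ) :
    ofPicture c ∈ upperTriangular (n + 1) := fun i j hij => by
  simp [ofPicture, hij.ne', hij.not_gt]

theorem toPicture_ofPicture {n : ℕ} {c : Matrix (Fin (n + 1)) (Fin (n + 1)) ℕ}
    (hc : c ∈ upperTriangular (n + 1)) : toPicture (ofPicture c) = c := by
  funext i j
  rcases lt_or_ge j i with h | h
  · rw [toPicture_mem _ _ _ h, hc _ _ h]
  · cases j using Fin.lastCases with
    | last => simp [toPicture_last, ofPicture]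
    | cast m =>
      have h' : i < m.succ := Fin.le_castSucc_iff.mp h
      simp [toPicture_castSucc _ h, ofPicture, h', h'.ne]

theorem ofPicture_toPicture {n : ℕ} {A : Matrix (Fin (n + 1)) (Fin (n + 1)) ℕ}
    (hA : A ∈ upperTriangular (n + 1)) : ofPicture (toPicture A) = A := by
  funext i j
  rcases lt_trichotomy j i with h | rfl | h
  · rw [ofPicture_mem _ _ _ h, hA _ _ h]
  · simp [ofPicture, toPicture_last]
  · cases j using Fin.cases with
    | zero => exact absurd h (Fin.not_lt_zero i)
    | succ m => simp [ofPicture, h, h.ne, toPicture_castSucc _ (Fin.le_castSucc_iff.mpr h)]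

theorem sum_Ici_toPicture {n : ℕ} (A : Matrix (Fin (n + 1)) (Fin (n + 1)) ℕ)
    (k : Fin (n + 1)) :
    ∑ j ∈ Finset.Ici k, (toPicture A k j : ℤ) = ∑ j ∈ Finset.Ici k, (A k j : ℤ) := by
  have h1 : ∑ j ∈ Finset.Ici k, (toPicture A k j : ℤ) =
      ∑ j, if k ≤ j then (toPicture A k j : ℤ) else 0 := by
    rw [← Finset.sum_filter]; congr 1; ext; simp
  have h2 : ∑ j ∈ Finset.Ioi k, (A k j : ℤ) = ∑ j, if k < j then (A k j : ℤ) else 0 := by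
    rw [← Finset.sum_filter]; congr 1; ext; simp
  rw [h1, ← Finset.Ioi_insert, Finset.sum_insert (by simp), h2,
    Fin.sum_univ_castSucc, Fin.sum_univ_succ]
  simp only [Fin.le_last, if_true, toPicture_last, Fin.not_lt_zero, if_false, zero_add]
  rw [add_comm]
  congr 1
  refine Finset.sum_congr rfl fun m _ => ?_
  simp only [Fin.le_castSucc_iff]
  split_ifs with h
  · rw [toPicture_castSucc _ (Fin.le_castSucc_iff.mpr h)]
  · rfl

theorem sum_Iic_toPicture {n : ℕ} (A : Matrix (Fin (n + 1)) (Fin (n + 1)) ℕ) (m : Fin n) :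
    ∑ i ∈ Finset.Iic m.castSucc, (toPicture A i m.castSucc : ℤ) =
      ∑ i ∈ Finset.Iio m.succ, (A i m.succ : ℤ) := by
  refine Finset.sum_congr ?_ fun i hi => ?_
  · ext; simp [Fin.le_castSucc_iff]
  · rw [toPicture_castSucc _ (Fin.le_castSucc_iff.mpr (Finset.mem_Iio.mp hi))]

/-- For constant height the weight telescopes to `h` times (first minus last basis vector).
`toPicture` preserves row sums and shifts the column sums above the diagonal by one, so the
coordinate equations become the hook sum equations. -/
theorem toPicture_mem_kostantPicturesOfHeight_iff {h n : ℕ}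
    {A : Matrix (Fin (n + 1)) (Fin (n + 1)) ℕ} :
    toPicture A ∈ kostantPicturesOfHeight (fun _ => (h : ℤ)) ↔
      ∀ k, hookSum A k = firstHook h (n + 1) k := by
  rw [mem_kostantPicturesOfHeight_iff_rows, and_iff_right (toPicture_mem A)]
  refine forall_congr' fun k => ?_
  cases k using Fin.cases with
  | zero =>
    have hz : ∀ m : Fin (n + 1), m.succ ≠ (0 : Fin (n + 1)).castSucc := fun m => by
      simp [Fin.succ_ne_zero]
    have hio : Finset.Iio (0 : Fin (n + 1)) = ∅ := by ext; simp
    simp only [hz, if_false, Finset.sum_const_zero, sub_zero, sum_Ici_toPicture, hookSum,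
      firstHook, hio, Finset.sum_empty, Fin.val_zero, if_true]
  | succ m =>
    have hz : ∀ l : Fin (n + 1), l.succ = m.succ.castSucc ↔ l = m.castSucc := fun l => by
      rw [← Fin.succ_castSucc, Fin.succ_inj]
    simp only [hz, Finset.sum_ite_eq', Finset.mem_univ, if_true, sum_Ici_toPicture,
      sum_Iic_toPicture, hookSum, firstHook, Fin.val_succ, Nat.succ_ne_zero, if_false, sub_self]

theorem ncard_teslerMatrices_eq {h w : ℕ} (hw : 1 ≤ w) :
    (teslerMatrices (firstHook h w)).ncard =
      (kostantPicturesOfHeight (fun _ : Fin w => (h : ℤ))).ncard := by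
  obtain ⟨n, rfl⟩ := Nat.exists_eq_add_of_le' hw
  refine Set.ncard_congr (fun A _ => toPicture A) (fun A hA => ?_) (fun A B hA hB hAB => ?_)
    fun c hc => ⟨ofPicture c, ⟨ofPicture_mem c, ?_⟩, toPicture_ofPicture hc.1⟩
  · exact toPicture_mem_kostantPicturesOfHeight_iff.mpr hA.2
  · rw [← ofPicture_toPicture hA.1, ← ofPicture_toPicture hB.1, hAB]
  · rw [← toPicture_mem_kostantPicturesOfHeight_iff, toPicture_ofPicture hc.1]
    exact hc

/-! ### Packings of long loops -/

/-- The loops around at least two vertices, recorded by their end points. -/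
abbrev LongLoop (w : ℕ) : Type := {p : Fin w × Fin w // p.1 < p.2}

/-- The multiplicities of long loops for which no vertex is enclosed more than `h` times. -/
def packings (h w : ℕ) : Set (LongLoop w → ℕ) :=
  {f | ∀ k : Fin w, ∑ p : LongLoop w with p.1.1 ≤ k ∧ k ≤ p.1.2, f p ≤ h}

/-- Complete a packing by loops around single vertices. -/
def completePacking (h : ℕ) {w : ℕ} (f : LongLoop w → ℕ) : Matrix (Fin w) (Fin w) ℕ := fun i j =>
  if hij : i < j then f ⟨(i, j), hij⟩ else
    if i = j then h - ∑ p : LongLoop w with p.1.1 ≤ i ∧ i ≤ p.1.2, f p else 0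

theorem coverage_eq {w : ℕ} (c : Matrix (Fin w) (Fin w) ℕ) (k : Fin w) :
    coverage c k = c k k + ∑ p : LongLoop w with p.1.1 ≤ k ∧ k ≤ p.1.2, c p.1.1 p.1.2 := by
  have h1 : coverage c k = ∑ x ∈ Finset.Iic k ×ˢ Finset.Ici k, c x.1 x.2 := by
    rw [coverage, Finset.sum_product]
  have h2 : Finset.Iic k ×ˢ Finset.Ici k = insert (k, k)
      ((Finset.univ.filter fun p : LongLoop w => p.1.1 ≤ k ∧ k ≤ p.1.2).map
        (Function.Embedding.subtype _)) := by
    ext ⟨i, j⟩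
    simp only [Finset.mem_product, Finset.mem_Iic, Finset.mem_Ici, Finset.mem_insert,
      Prod.mk.injEq, Finset.mem_map, Finset.mem_filter, Finset.mem_univ, true_and,
      Function.Embedding.subtype_apply, Subtype.exists, Prod.exists]
    constructor
    · rintro ⟨h1, h2⟩
      rcases (h1.trans h2).eq_or_lt with h | h
      · subst h
        exact Or.inl ⟨le_antisymm h1 h2, le_antisymm h1 h2⟩
      · exact Or.inr ⟨i, j, h, ⟨h1, h2⟩, rfl, rfl⟩
    · rintro (⟨rfl, rfl⟩ | ⟨a, b, -, h, rfl, rfl⟩)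
      · exact ⟨le_rfl, le_rfl⟩
      · exact h
  rw [h1, h2, Finset.sum_insert, Finset.sum_map]
  · rfl
  · simp

theorem ncard_kostantPicturesOfHeight_eq (h w : ℕ) :
    (kostantPicturesOfHeight (fun _ : Fin w => (h : ℤ))).ncard = (packings h w).ncard := by
  refine Set.ncard_congr (fun c _ (p : LongLoop w) => c p.1.1 p.1.2) (fun c hc => ?_)
    (fun c d hc hd hcd => ?_) fun f hf => ⟨completePacking h f, ?_, ?_⟩
  · obtain ⟨-, hc⟩ := mem_kostantPicturesOfHeight_iff_coverage.mp hc
    intro k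
    have := hc k
    rw [coverage_eq] at this
    have h2 : c k k + ∑ p : LongLoop w with p.1.1 ≤ k ∧ k ≤ p.1.2, c p.1.1 p.1.2 = h := by
      exact_mod_cast this
    exact (Nat.le_add_left _ _).trans h2.le
  · obtain ⟨hcu, hc⟩ := mem_kostantPicturesOfHeight_iff_coverage.mp hc
    obtain ⟨hdu, hd⟩ := mem_kostantPicturesOfHeight_iff_coverage.mp hd
    have hlt : ∀ p : LongLoop w, c p.1.1 p.1.2 = d p.1.1 p.1.2 := fun p => congrFun hcd p
    funext i j
    rcases lt_trichotomy i j with hij | rfl | hij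
    · exact hlt ⟨(i, j), hij⟩
    · have h1 := (hc i).trans (hd i).symm
      simp only [coverage_eq, hlt] at h1
      exact Nat.add_right_cancel (by exact_mod_cast h1)
    · rw [hcu _ _ hij, hdu _ _ hij]
  · refine mem_kostantPicturesOfHeight_iff_coverage.mpr ⟨fun i j hij => ?_, fun k => ?_⟩
    · simp [completePacking, hij.not_gt, hij.ne']
    · have hp : ∀ p : LongLoop w, completePacking h f p.1.1 p.1.2 = f p := fun p => by
        simp [completePacking, p.2]
      simp only [coverage_eq, hp]
      have : completePacking h f k k = h - ∑ p : LongLoop w with p.1.1 ≤ k ∧ k ≤ p.1.2, f p := by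
        simp [completePacking]
      -- The packing inequality at `k` makes the truncated subtraction exact.
      rw [this, Nat.sub_add_cancel (hf k)]
  · funext p
    simp [completePacking, p.2]

theorem L_eq_log_ncard_packings {h w : ℕ} (hw : 1 ≤ w) :
    L h w = Real.log (packings h w).ncard := by
  rw [L, ncard_teslerMatrices_eq hw, ncard_kostantPicturesOfHeight_eq]

theorem packings_apply_le {h w : ℕ} {f : LongLoop w → ℕ} (hf : f ∈ packings h w)
    (p : LongLoop w) : f p ≤ h :=
  (Finset.single_le_sum (f := f) (fun _ _ => Nat.zero_le _)
    (Finset.mem_filter.mpr ⟨Finset.mem_univ p, le_rfl, p.2.le⟩)).trans (hf p.1.1)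

theorem finite_packings (h w : ℕ) : (packings h w).Finite :=
  (Set.finite_Iic (fun _ : LongLoop w => h)).subset fun _ hf p => packings_apply_le hf p

theorem packings_nonempty (h w : ℕ) : (packings h w).Nonempty :=
  ⟨0, fun k => by simp⟩

/-! ### Loop lengths and the generating-function upper bound -/

/-- The number of vertices enclosed by a loop. -/
def LongLoop.length {w : ℕ} (p : LongLoop w) : ℕ := p.1.2 + 1 - p.1.1

theorem sum_longLoop {w : ℕ} {M : Type*} [AddCommMonoid M] (F : Fin w → Fin w → M) :
    ∑ p : LongLoop w, F p.1.1 p.1.2 = ∑ i, ∑ j ∈ Finset.Ioi i, F i j := by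
  rw [← Finset.sum_subtype (Finset.univ.filter fun p : Fin w × Fin w => p.1 < p.2)
    (p := fun p => p.1 < p.2) (by simp) (fun p => F p.1 p.2), Finset.sum_filter, Fintype.sum_prod_type]
  refine Finset.sum_congr rfl fun i _ => ?_
  rw [← Finset.sum_filter]
  congr 1
  ext
  simp

theorem sum_length {w : ℕ} {M : Type*} [AddCommMonoid M] (G : ℕ → M) :
    ∑ p : LongLoop w, G p.length = ∑ i ∈ Finset.range w, ∑ u ∈ Finset.Icc 2 (w - i), G u := by
  rw [← Fin.sum_univ_eq_sum_range (fun i => ∑ u ∈ Finset.Icc 2 (w - i), G u)]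
  refine (sum_longLoop fun i j : Fin w => G (j + 1 - i)).trans
    (Finset.sum_congr rfl fun i _ => ?_)
  refine Finset.sum_bij (fun j _ => (j : ℕ) + 1 - i) ?_ ?_ ?_ fun _ _ => rfl
  · intro j hj
    have : (i : ℕ) < j := Fin.lt_def.mp (Finset.mem_Ioi.mp hj)
    simp only [Finset.mem_Icc]
    omega
  · intro j hj k hk h
    have : (i : ℕ) < j := Fin.lt_def.mp (Finset.mem_Ioi.mp hj)
    have : (i : ℕ) < k := Fin.lt_def.mp (Finset.mem_Ioi.mp hk)
    exact Fin.ext (by omega)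
  · intro u hu
    rw [Finset.mem_Icc] at hu
    refine ⟨⟨i + u - 1, by omega⟩, Finset.mem_Ioi.mpr (Fin.lt_def.mpr ?_), ?_⟩
    · change (i : ℕ) < i + u - 1
      omega
    · change (i + u - 1 : ℕ) + 1 - i = u
      omega

theorem card_longLoop (w : ℕ) : Fintype.card (LongLoop w) * 2 = w * (w - 1) := by
  have h := sum_length (w := w) fun _ => 1
  simp only [Finset.sum_const, Finset.card_univ, smul_eq_mul, mul_one, Nat.card_Icc] at h
  rw [h, ← Finset.sum_range_id_mul_two, ← Finset.sum_range_reflect]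
  congr 1
  refine Finset.sum_congr rfl fun i hi => ?_
  rw [Finset.mem_range] at hi
  omega

theorem sum_length_le {w : ℕ} {G : ℕ → ℝ} (hG : ∀ u ∈ Finset.Icc 2 w, 0 ≤ G u) :
    ∑ p : LongLoop w, G p.length ≤ w * ∑ u ∈ Finset.Icc 2 w, G u := by
  rw [sum_length]
  calc _ ≤ ∑ _i ∈ Finset.range w, ∑ u ∈ Finset.Icc 2 w, G u := by
        refine Finset.sum_le_sum fun i _ => Finset.sum_le_sum_of_subset_of_nonneg
          (Finset.Icc_subset_Icc_right (Nat.sub_le w i)) fun u hu _ => hG u hu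
    _ = _ := by simp

theorem length_le {w : ℕ} (p : LongLoop w) : p.length ≤ w := by
  have := p.1.2.isLt
  unfold LongLoop.length
  omega

theorem two_le_length {w : ℕ} (p : LongLoop w) : 2 ≤ p.length := by
  have : (p.1.1 : ℕ) < p.1.2 := p.2
  unfold LongLoop.length
  omega

/-- Double counting of incidences between vertices and loops. -/
theorem sum_length_mul_le {h w : ℕ} {f : LongLoop w → ℕ} (hf : f ∈ packings h w) :
    ∑ p, p.length * f p ≤ w * h := by
  calc ∑ p, p.length * f p
      = ∑ p : LongLoop w, ∑ k : Fin w with p.1.1 ≤ k ∧ k ≤ p.1.2, f p := by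
        refine Finset.sum_congr rfl fun p _ => ?_
        rw [Finset.sum_const, smul_eq_mul, LongLoop.length, ← Fin.card_Icc]
        congr 2
        ext
        simp
    _ = ∑ k : Fin w, ∑ p : LongLoop w with p.1.1 ≤ k ∧ k ≤ p.1.2, f p :=
        Finset.sum_comm' (by simp)
    _ ≤ ∑ _k : Fin w, h := Finset.sum_le_sum fun k _ => hf k
    _ = w * h := by simp

/-- An exponential Markov bound: each packing has weight at least `exp (-β w h)`, while the total
weight of all multiplicity functions is a product of geometric series. -/
theorem L_le {h w : ℕ} (hw : 1 ≤ w) {β : ℝ} (hβ : 0 < β) :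
    L h w ≤ β * (w * h) + ∑ p : LongLoop w, -Real.log (1 - Real.exp (-(β * p.length))) := by
  classical
  rw [L_eq_log_ncard_packings hw]
  set x : LongLoop w → ℝ := fun p => Real.exp (-(β * p.length)) with hx
  have hx0 : ∀ p, 0 < x p := fun p => Real.exp_pos _
  have hx1 : ∀ p, x p < 1 := fun p => Real.exp_lt_one_iff.mpr (by
    have := two_le_length p
    have : (0 : ℝ) < p.length := by exact_mod_cast (by omega : 0 < p.length)
    exact neg_lt_zero.mpr (mul_pos hβ this))
  set S := (finite_packings h w).toFinset
  have hS : (packings h w).ncard = S.card := Set.ncard_eq_toFinset_card _ _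
  have hSpos : 0 < S.card := by
    rw [← hS, Set.ncard_pos (finite_packings h w)]
    exact packings_nonempty h w
  have key : (S.card : ℝ) * Real.exp (-(β * (w * h))) ≤ ∏ p, (1 - x p)⁻¹ := by
    calc (S.card : ℝ) * Real.exp (-(β * (w * h)))
        = ∑ _f ∈ S, Real.exp (-(β * (w * h))) := by simp
      _ ≤ ∑ f ∈ S, ∏ p, x p ^ f p := by
          refine Finset.sum_le_sum fun f hf => ?_
          simp only [hx, ← Real.exp_nat_mul, ← Real.exp_sum]
          refine Real.exp_le_exp.mpr ?_
          have hf' : ((∑ p, p.length * f p : ℕ) : ℝ) ≤ ((w * h : ℕ) : ℝ) :=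
            Nat.cast_le.mpr (sum_length_mul_le ((finite_packings h w).mem_toFinset.mp hf))
          push_cast at hf'
          calc -(β * (w * h)) ≤ -(β * ∑ p : LongLoop w, (p.length : ℝ) * f p) := by gcongr
            _ = _ := by
              rw [Finset.mul_sum, ← Finset.sum_neg_distrib]
              exact Finset.sum_congr rfl fun p _ => by ring
      _ ≤ ∑ f ∈ Fintype.piFinset fun _ : LongLoop w => Finset.range (h + 1),
            ∏ p, x p ^ f p := by
          refine Finset.sum_le_sum_of_subset_of_nonneg (fun f hf => ?_)
            fun f _ _ => Finset.prod_nonneg fun p _ => (pow_pos (hx0 p) _).le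
          exact Fintype.mem_piFinset.mpr fun p => Finset.mem_range_succ_iff.mpr
            (packings_apply_le ((finite_packings h w).mem_toFinset.mp hf) p)
      _ = ∏ p, ∑ m ∈ Finset.range (h + 1), x p ^ m :=
          (Finset.prod_univ_sum (fun _ => Finset.range (h + 1)) fun p m => x p ^ m).symm
      _ ≤ _ := by
          refine Finset.prod_le_prod (fun p _ => Finset.sum_nonneg fun m _ =>
            (pow_pos (hx0 p) _).le) fun p _ => ?_
          rw [← tsum_geometric_of_lt_one (hx0 p).le (hx1 p)]
          exact (summable_geometric_of_lt_one (hx0 p).le (hx1 p)).sum_le_tsum _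
            fun m _ => (pow_pos (hx0 p) _).le
  have hlog := Real.log_le_log (mul_pos (Nat.cast_pos.mpr hSpos) (Real.exp_pos _)) key
  rw [Real.log_mul (Nat.cast_pos.mpr hSpos).ne' (Real.exp_ne_zero _), Real.log_exp,
    Real.log_prod (fun p _ => (inv_pos.mpr (sub_pos.mpr (hx1 p))).ne')] at hlog
  simp only [Real.log_inv] at hlog
  rw [hS]
  linarith

/-! ### Lower bound from independent multiplicities -/

theorem le_L_of_subset {h w : ℕ} (hw : 1 ≤ w) {S : Finset (LongLoop w → ℕ)}
    (hS : (S : Set (LongLoop w → ℕ)) ⊆ packings h w) (h0 : S.Nonempty) :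
    Real.log S.card ≤ L h w := by
  rw [L_eq_log_ncard_packings hw]
  refine Real.log_le_log (Nat.cast_pos.mpr h0.card_pos) (Nat.cast_le.mpr ?_)
  rw [← Set.ncard_coe_finset]
  exact Set.ncard_le_ncard hS (finite_packings h w)

/-- There are at most `w ^ 2` long loops, so multiplicities up to `h / w ^ 2` can be chosen
independently without overfilling a vertex. -/
theorem card_mul_log_le_L {h w : ℕ} (hh : 1 ≤ h) (hw : 1 ≤ w) :
    Fintype.card (LongLoop w) * Real.log (h / (w : ℝ) ^ 2) ≤ L h w := by
  classical
  set m := h / w ^ 2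
  have hq : Fintype.card (LongLoop w) ≤ w ^ 2 := by
    have h1 := card_longLoop w
    have h2 : w * (w - 1) ≤ w ^ 2 := by
      rw [pow_two]
      exact Nat.mul_le_mul_left w (Nat.sub_le w 1)
    omega
  refine le_trans ?_ (le_L_of_subset hw
    (S := Fintype.piFinset fun _ : LongLoop w => Finset.range (m + 1)) (fun f hf k => ?_) ?_)
  · simp only [Fintype.card_piFinset, Finset.prod_const, Finset.card_range, Finset.card_univ]
    rw [Nat.cast_pow, Real.log_pow]
    refine mul_le_mul_of_nonneg_left (Real.log_le_log (by positivity) ?_) (Nat.cast_nonneg _)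
    rw [← Nat.cast_pow]
    exact_mod_cast (Nat.lt_floor_add_one ((h : ℝ) / (w ^ 2 : ℕ))).le.trans_eq (by
      rw [Nat.floor_div_eq_div, Nat.cast_succ])
  · have hf' : ∀ p, f p ≤ m := fun p => Finset.mem_range_succ_iff.mp
      (Fintype.mem_piFinset.mp (Finset.mem_coe.mp hf) p)
    calc ∑ p : LongLoop w with p.1.1 ≤ k ∧ k ≤ p.1.2, f p ≤ ∑ p : LongLoop w, f p :=
          Finset.sum_le_univ_sum_of_nonneg fun _ => Nat.zero_le _
      _ ≤ ∑ _p : LongLoop w, m := Finset.sum_le_sum fun p _ => hf' p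
      _ = Fintype.card (LongLoop w) * m := by simp
      _ ≤ w ^ 2 * m := Nat.mul_le_mul_right _ hq
      _ ≤ h := Nat.mul_div_le h _
  · exact ⟨0, Fintype.mem_piFinset.mpr fun p => by simp⟩

/-! ### Lower bound from loops between blocks -/

/-- The functions to `ℕ` with sum at most `m`. -/
def boundedSum (ι : Type*) [Fintype ι] [DecidableEq ι] (m : ℕ) : Finset (ι → ℕ) :=
  (Finset.finsuppAntidiag (Finset.univ : Finset (Option ι)) m).image fun g i => g (some i)

theorem sum_le_of_mem_boundedSum {ι : Type*} [Fintype ι] [DecidableEq ι] {m : ℕ} {f : ι → ℕ}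
    (hf : f ∈ boundedSum ι m) : ∑ i, f i ≤ m := by
  obtain ⟨g, hg, rfl⟩ := Finset.mem_image.mp hf
  rw [Finset.mem_finsuppAntidiag, Fintype.sum_option] at hg
  exact (Nat.le_add_left _ _).trans hg.1.le

/-- Stars and bars; the extra index `none` is a slack variable turning the inequality into an
equality. -/
theorem card_boundedSum (ι : Type*) [Fintype ι] [DecidableEq ι] (m : ℕ) :
    (boundedSum ι m).card = (Fintype.card ι + m).choose m := by
  rw [boundedSum, Finset.card_image_of_injOn, Finset.card_finsuppAntidiag_nat_eq_choose,
    Finset.card_univ, Fintype.card_option]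
  · congr 1
    omega
  · intro g hg g' hg' h
    have hg := (Finset.mem_finsuppAntidiag.mp hg).1
    have hg' := (Finset.mem_finsuppAntidiag.mp hg').1
    have hs : ∀ i, g (some i) = g' (some i) := fun i => congrFun h i
    rw [Fintype.sum_option] at hg hg'
    simp only [hs] at hg
    ext i
    cases i with
    | none => omega
    | some i => exact hs i

/-- Functions whose sum over each fibre of a map is bounded. -/
theorem exists_finset_fiberwise_sum_le {P Q : Type*} [Fintype P] [DecidableEq P] [Fintype Q]
    [DecidableEq Q] (π : P → Q) (cap : Q → ℕ) :
    ∃ S : Finset (P → ℕ), (∀ f ∈ S, ∀ q, ∑ p with π p = q, f p ≤ cap q) ∧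
      S.card = ∏ q, (Fintype.card {p // π p = q} + cap q).choose (cap q) := by
  classical
  refine ⟨(Fintype.piFinset fun q => boundedSum {p // π p = q} (cap q)).image
    fun g p => g (π p) ⟨p, rfl⟩, fun f hf q => ?_, ?_⟩
  · obtain ⟨g, hg, rfl⟩ := Finset.mem_image.mp hf
    refine le_trans (le_of_eq ?_) (sum_le_of_mem_boundedSum (Fintype.mem_piFinset.mp hg q))
    rw [Finset.sum_subtype (p := fun p => π p = q) _ (by simp)]
    refine Finset.sum_congr rfl fun p _ => ?_
    obtain ⟨p, rfl⟩ := p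
    rfl
  · rw [Finset.card_image_of_injective, Fintype.card_piFinset]
    · simp only [card_boundedSum]
    · intro g g' h
      funext q p
      obtain ⟨p, rfl⟩ := p
      exact congrFun h p

/-- The block that contains a vertex, when the vertices are cut into blocks of size `s`. -/
def block (s : ℕ) {w : ℕ} (i : Fin w) : Fin w := ⟨i / s, (Nat.div_le_self _ _).trans_lt i.isLt⟩

/-- The pair of blocks that contain the end points of a loop. -/
def blocks (s : ℕ) {w : ℕ} (p : LongLoop w) : Fin w × Fin w := (block s p.1.1, block s p.1.2)

theorem sq_le_card_blocks {s w : ℕ} {q : Fin w × Fin w} (h1 : q.1 < q.2)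
    (h2 : (q.2 + 1) * s ≤ w) :
    s ^ 2 ≤ Fintype.card {p : LongLoop w // blocks s p = q} := by
  obtain ⟨⟨a, ha⟩, ⟨b, hb⟩⟩ := q
  have hab : a + 1 ≤ b := Fin.lt_def.mp h1
  change (b + 1) * s ≤ w at h2
  have hsab : (a + 1) * s ≤ b * s := Nat.mul_le_mul_right s hab
  have hb' : (b + 1) * s = b * s + s := by ring
  have ha' : (a + 1) * s = a * s + s := by ring
  have hcard : s ^ 2 = Fintype.card (Fin s × Fin s) := by simp [pow_two]
  rw [hcard]
  refine Fintype.card_le_of_injective (fun x => ⟨⟨(⟨a * s + x.1, ?_⟩, ⟨b * s + x.2, ?_⟩), ?_⟩, ?_⟩)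
    fun x y hxy => ?_
  · omega
  · omega
  · refine Fin.lt_def.mpr ?_
    change a * s + x.1 < b * s + x.2
    omega
  · have hdiv : ∀ (c : ℕ) (y : Fin s), (c * s + y) / s = c := fun c y => by
      rw [mul_comm, Nat.mul_add_div (y.pos), Nat.div_eq_of_lt y.isLt, add_zero]
    simp [blocks, block, hdiv]
  · simp only [Subtype.mk.injEq, Prod.mk.injEq, Fin.mk.injEq, Nat.add_left_cancel_iff] at hxy
    exact Prod.ext (Fin.ext hxy.1) (Fin.ext hxy.2)

/-- The bound on the multiplicity of loops between two blocks, as a function of the distance. -/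
def blockCap (T : ℕ) (m : ℕ → ℕ) {w : ℕ} (q : Fin w × Fin w) : ℕ :=
  if q.1 < q.2 ∧ (q.2 : ℕ) ≤ q.1 + T then m (q.2 - q.1 - 1) else 0

theorem sum_blockCap_le (T : ℕ) (m : ℕ → ℕ) {w : ℕ} (κ : Fin w) :
    ∑ q : Fin w × Fin w with q.1 ≤ κ ∧ κ ≤ q.2, blockCap T m q ≤
      ∑ t ∈ Finset.range T, (t + 2) * m t := by
  simp only [blockCap]
  rw [← Finset.sum_filter, Finset.filter_filter,
    ← Finset.sum_fiberwise_of_maps_to (t := Finset.range T)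
      (g := fun q : Fin w × Fin w => (q.2 - q.1 - 1 : ℕ))]
  · refine Finset.sum_le_sum fun t _ => ?_
    rw [Finset.sum_congr rfl fun q hq => by rw [(Finset.mem_filter.mp hq).2], Finset.sum_const,
      smul_eq_mul]
    -- A pair at distance `t + 1` that encloses `κ` is determined by its first block, which lies
    -- among the `t + 2` indices ending at `κ`.
    refine Nat.mul_le_mul_right _ ?_
    refine (Finset.card_le_card_of_injOn (t := Finset.Icc (κ - (t + 1) : ℕ) κ)
      (fun q => (q.1 : ℕ)) (fun q hq => ?_) fun q hq q' hq' h => ?_).trans ?_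
    · simp only [Finset.coe_filter, Finset.mem_filter, Finset.mem_univ, true_and,
        Set.mem_ofPred_eq, Fin.le_def, Fin.lt_def] at hq
      simp only [Finset.coe_Icc, Set.mem_Icc]
      omega
    · simp only [Finset.coe_filter, Finset.mem_filter, Finset.mem_univ, true_and,
        Set.mem_ofPred_eq, Fin.le_def, Fin.lt_def] at hq hq'
      have h' : (q.1 : ℕ) = q'.1 := h
      exact Prod.ext (Fin.ext h') (Fin.ext (by omega))
    · rw [Nat.card_Icc]
      omega
  · intro q hq
    simp only [Finset.mem_filter, Finset.mem_univ, true_and, Fin.le_def, Fin.lt_def] at hq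
    rw [Finset.mem_range]
    omega

/-- The lower bound from loops joining blocks of size `s` at distance at most `T`. -/
theorem mul_sum_log_choose_le_L {h w : ℕ} (hw : 1 ≤ w) (s T : ℕ) (m : ℕ → ℕ)
    (hm : ∑ t ∈ Finset.range T, (t + 2) * m t ≤ h) :
    ((w / s - T : ℕ) : ℝ) * ∑ t ∈ Finset.range T, Real.log ((s ^ 2 + m t).choose (m t)) ≤
      L h w := by
  classical
  obtain ⟨S, hS, hcard⟩ := exists_finset_fiberwise_sum_le (blocks s (w := w)) (blockCap T m)
  have hpos : ∀ q : Fin w × Fin w,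
      0 < (Fintype.card {p // blocks s p = q} + blockCap T m q).choose (blockCap T m q) :=
    fun q => Nat.choose_pos (Nat.le_add_left _ _)
  refine le_trans ?_ (le_L_of_subset hw (S := S) (fun f hf k => ?_) ?_)
  · rw [hcard, Nat.cast_prod, Real.log_prod fun q _ => Nat.cast_ne_zero.mpr (hpos q).ne']
    -- Keep only the pairs of blocks `(a, a + t + 1)` with `a < w / s - T`: both blocks are then
    -- complete, so `s ^ 2` loops join them. The other factors are at least one and are dropped.
    have hlt : ∀ (a : Fin (w / s - T)) (t : Fin T), (a + t + 1 : ℕ) < w := fun a t => by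
      have := Nat.div_le_self w s
      have := a.isLt
      have := t.isLt
      omega
    let e : Fin (w / s - T) × Fin T ↪ Fin w × Fin w :=
      ⟨fun x => (⟨x.1, by have := hlt x.1 x.2; omega⟩, ⟨x.1 + x.2 + 1, hlt x.1 x.2⟩),
        fun x y hxy => by
          simp only [Prod.mk.injEq, Fin.mk.injEq] at hxy
          obtain ⟨h1, h2⟩ := hxy
          exact Prod.ext (Fin.ext h1) (Fin.ext (by omega))⟩
    calc ((w / s - T : ℕ) : ℝ) * ∑ t ∈ Finset.range T, Real.log ((s ^ 2 + m t).choose (m t))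
        = ∑ x : Fin (w / s - T) × Fin T, Real.log ((s ^ 2 + m x.2).choose (m x.2)) := by
          rw [Fintype.sum_prod_type]
          simp [Fin.sum_univ_eq_sum_range fun t => Real.log ((s ^ 2 + m t).choose (m t))]
      _ ≤ ∑ x : Fin (w / s - T) × Fin T, Real.log ((Fintype.card {p // blocks s p = e x} +
            blockCap T m (e x)).choose (blockCap T m (e x))) := by
          refine Finset.sum_le_sum fun x _ => ?_
          have h1 : (e x).1 < (e x).2 := Fin.lt_def.mpr (by change (x.1 : ℕ) < x.1 + x.2 + 1; omega)
          have h2 : blockCap T m (e x) = m x.2 := by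
            have h3 : ((e x).2 : ℕ) ≤ (e x).1 + T := by
              change (x.1 + x.2 + 1 : ℕ) ≤ x.1 + T
              omega
            rw [blockCap, if_pos ⟨h1, h3⟩]
            congr 1
            change (x.1 + x.2 + 1 - x.1 - 1 : ℕ) = x.2
            omega
          have h4 : s ^ 2 ≤ Fintype.card {p : LongLoop w // blocks s p = e x} := by
            refine sq_le_card_blocks h1 ?_
            change (x.1 + x.2 + 1 + 1 : ℕ) * s ≤ w
            exact (Nat.mul_le_mul_right s (by omega : (x.1 + x.2 + 1 + 1 : ℕ) ≤ w / s)).trans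
              (Nat.div_mul_le_self w s)
          rw [h2]
          exact Real.log_le_log (Nat.cast_pos.mpr (Nat.choose_pos (Nat.le_add_left _ _)))
            (Nat.cast_le.mpr (Nat.choose_le_choose _ (Nat.add_le_add_right h4 _)))
      _ ≤ _ := by
          rw [← Finset.sum_map Finset.univ e fun q => Real.log
            ((Fintype.card {p // blocks s p = q} + blockCap T m q).choose (blockCap T m q))]
          exact Finset.sum_le_sum_of_subset_of_nonneg (Finset.subset_univ _)
            fun q _ _ => Real.log_natCast_nonneg _
  · calc ∑ p : LongLoop w with p.1.1 ≤ k ∧ k ≤ p.1.2, f p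
        ≤ ∑ p : LongLoop w with (blocks s p).1 ≤ block s k ∧ block s k ≤ (blocks s p).2, f p := by
          refine Finset.sum_le_sum_of_subset (Finset.monotone_filter_right _ fun p _ hp => ?_)
          exact ⟨Fin.le_def.mpr (Nat.div_le_div_right hp.1),
            Fin.le_def.mpr (Nat.div_le_div_right hp.2)⟩
      _ = ∑ q : Fin w × Fin w with q.1 ≤ block s k ∧ block s k ≤ q.2,
            ∑ p with blocks s p = q, f p := by
          rw [← Finset.sum_fiberwise_of_maps_to (g := blocks s)
            (t := Finset.univ.filter fun q : Fin w × Fin w => q.1 ≤ block s k ∧ block s k ≤ q.2)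
            (fun p hp => by simpa using hp)]
          refine Finset.sum_congr rfl fun q hq => ?_
          congr 1
          ext p
          simp only [Finset.mem_filter, Finset.mem_univ, true_and] at hq ⊢
          exact ⟨fun h => h.2, fun h => ⟨h ▸ hq, h⟩⟩
      _ ≤ ∑ q : Fin w × Fin w with q.1 ≤ block s k ∧ block s k ≤ q.2, blockCap T m q :=
          Finset.sum_le_sum fun q _ => hS f (Finset.mem_coe.mp hf) q
      _ ≤ h := (sum_blockCap_le T m _).trans hm
  · rw [← Finset.card_pos, hcard]
    exact Finset.prod_pos fun q _ => hpos q

/-! ### Estimates for factorials and binomial coefficients -/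

theorem log_factorial_le (n : ℕ) :
    Real.log n.factorial ≤ (n + 1) * Real.log (n + 1) - n := by
  induction n with
  | zero => simp
  | succ n ih =>
    have h1 : (0 : ℝ) < n + 1 := by positivity
    have h2 : (0 : ℝ) < n + 2 := by positivity
    rw [Nat.factorial_succ, Nat.cast_mul, Real.log_mul (by positivity) (by positivity)]
    push_cast
    have h3 := Real.one_sub_inv_le_log_of_pos (div_pos h2 h1)
    rw [Real.log_div h2.ne' h1.ne', inv_div] at h3
    have h4 : (n + 2 : ℝ) * (1 - (n + 1) / (n + 2)) = 1 := by field_simp; ring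
    have h5 := mul_le_mul_of_nonneg_left h3 h2.le
    rw [h4] at h5
    rw [show (n + 1 + 1 : ℝ) = n + 2 by ring]
    linarith

theorem le_log_factorial (n : ℕ) : n * Real.log n - n ≤ Real.log n.factorial := by
  rcases n.eq_zero_or_pos with rfl | hn
  · simp
  have hn' : (0 : ℝ) < n := Nat.cast_pos.mpr hn
  have h := Real.log_le_log (by positivity) (Real.pow_div_factorial_le_exp (n : ℝ) hn'.le n)
  rw [Real.log_exp, Real.log_div (by positivity) (by positivity), Real.log_pow] at h
  linarith

theorem le_log_choose (q m : ℕ) :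
    ((q : ℝ) + m) * Real.log (q + m) - (m + 1) * Real.log (m + 1) - (q + 1) * Real.log (q + 1) ≤
      Real.log ((q + m).choose m) := by
  have h : ((q + m).choose m : ℝ) * m.factorial * q.factorial = (q + m).factorial := by
    have := Nat.choose_mul_factorial_mul_factorial (Nat.le_add_left m q)
    rw [Nat.add_sub_cancel] at this
    exact_mod_cast this
  have hc : (0 : ℝ) < (q + m).choose m := Nat.cast_pos.mpr (Nat.choose_pos (Nat.le_add_left _ _))
  have hl := congrArg Real.log h
  rw [Real.log_mul (by positivity) (by positivity), Real.log_mul (by positivity) (by positivity)]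
    at hl
  have h1 := log_factorial_le m
  have h2 := log_factorial_le q
  have h3 := le_log_factorial (q + m)
  push_cast at h3
  linarith

open Topology in
/-- The asymptotic lower bound on binomial coefficients by the entropy of a geometric law. -/
theorem eventually_le_log_choose {y ε : ℝ} (hy : 0 < y) (hε : 0 < ε) :
    ∀ᶠ q : ℕ in atTop, q * (y * (Real.exp y - 1)⁻¹ - Real.log (1 - Real.exp (-y)) - ε) ≤
      Real.log ((q + ⌊q * (Real.exp y - 1)⁻¹⌋₊).choose ⌊q * (Real.exp y - 1)⁻¹⌋₊) := by
  have he : 0 < Real.exp y - 1 := sub_pos.mpr (Real.one_lt_exp_iff.mpr hy)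
  set μ := (Real.exp y - 1)⁻¹ with hμdef
  have hμ : 0 < μ := inv_pos.mpr he
  set φ : ℝ → ℝ := fun x => x * Real.log x with hφdef
  have hφ : Continuous φ := Real.continuous_mul_log
  set a : ℕ → ℝ := fun q => (⌊q * μ⌋₊ : ℝ) / q with hadef
  have ha : Tendsto a atTop (𝓝 μ) := by
    have := (tendsto_nat_floor_mul_div_atTop hμ.le).comp (tendsto_natCast_atTop_atTop (R := ℝ))
    refine this.congr fun q => ?_
    simp [hadef, mul_comm]
  have hinv : Tendsto (fun q : ℕ => (q : ℝ)⁻¹) atTop (𝓝 0) := tendsto_inv_atTop_nhds_zero_nat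
  have hlog : Tendsto (fun q : ℕ => Real.log q / q) atTop (𝓝 0) :=
    (Real.isLittleO_log_id_atTop.tendsto_div_nhds_zero).comp tendsto_natCast_atTop_atTop
  -- This is the bound of `le_log_choose` divided by `q`, with `φ x = x log x`. The terms in `log q`
  -- cancel up to `-2 log q / q`.
  have hlim : Tendsto (fun q : ℕ => φ (1 + a q) - φ (a q + (q : ℝ)⁻¹) - φ (1 + (q : ℝ)⁻¹) -
      2 * (Real.log q / q)) atTop (𝓝 (φ (1 + μ) - φ (μ + 0) - φ (1 + 0) - 2 * 0)) :=
    ((((hφ.tendsto _).comp (ha.const_add 1)).sub ((hφ.tendsto _).comp (ha.add hinv))).sub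
      ((hφ.tendsto _).comp (hinv.const_add 1))).sub (hlog.const_mul 2)
  have hval : φ (1 + μ) - φ (μ + 0) - φ (1 + 0) - 2 * 0 =
      y * μ - Real.log (1 - Real.exp (-y)) := by
    have h1 : 1 + μ = Real.exp y * μ := by
      rw [hμdef]; field_simp; ring
    have h2 : 1 - Real.exp (-y) = (Real.exp y * μ)⁻¹ := by
      rw [hμdef, Real.exp_neg]; field_simp
    simp only [hφdef, add_zero, Real.log_one, mul_zero, sub_zero]
    have h3 : Real.log (Real.exp y * μ) = y + Real.log μ := by
      rw [Real.log_mul (Real.exp_ne_zero _) hμ.ne', Real.log_exp]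
    clear_value μ
    rw [← h1] at h2 h3
    rw [h2, Real.log_inv, h3]
    ring
  rw [hval] at hlim
  filter_upwards [hlim.eventually_const_lt (sub_lt_self _ hε), eventually_gt_atTop 0] with q hq hq0
  have hq' : (0 : ℝ) < q := Nat.cast_pos.mpr hq0
  refine (mul_le_mul_of_nonneg_left hq.le hq'.le).trans ((le_of_eq ?_).trans (le_log_choose _ _))
  have hm : (⌊q * μ⌋₊ : ℝ) = q * a q := by simp only [hadef]; field_simp
  have ha0 : 0 ≤ a q := by positivity
  rw [hm]
  simp only [hφdef]
  rw [show (q : ℝ) + q * a q = q * (1 + a q) by ring,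
    show (q : ℝ) * a q + 1 = q * (a q + (q : ℝ)⁻¹) by field_simp,
    show (q : ℝ) + 1 = q * (1 + (q : ℝ)⁻¹) by field_simp,
    Real.log_mul hq'.ne' (by positivity), Real.log_mul hq'.ne' (by positivity),
    Real.log_mul hq'.ne' (by positivity)]
  field_simp
  ring

/-! ### The growth constant and the upper bound for wide pictures -/

/-- `- ∑ log (1 - exp (-θ u))`, summed over `u = 2, …, T + 1`. -/
noncomputable def loopEntropy (θ : ℝ) (T : ℕ) : ℝ :=
  ∑ t ∈ Finset.range T, -Real.log (1 - Real.exp (-(θ * (t + 2))))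

theorem neg_log_one_sub_exp_pos {y : ℝ} (hy : 0 < y) : 0 < -Real.log (1 - Real.exp (-y)) := by
  have h1 : Real.exp (-y) < 1 := Real.exp_lt_one_iff.mpr (neg_lt_zero.mpr hy)
  exact neg_pos.mpr (Real.log_neg (sub_pos.mpr h1) (sub_lt_self _ (Real.exp_pos _)))

theorem loopEntropy_nonneg {θ : ℝ} (hθ : 0 < θ) (T : ℕ) : 0 ≤ loopEntropy θ T :=
  Finset.sum_nonneg fun t _ => (neg_log_one_sub_exp_pos (by positivity)).le

/-- Expand the logarithm and sum over `t` first. With `x = exp (-θ (m + 1))` the `m`-th term is at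
most `θ x / ((m + 1) (1 - x))`, and `exp z ≥ 1 + z` gives `θ (m + 1) x ≤ 1 - x`. -/
theorem mul_loopEntropy_le {θ : ℝ} (hθ : 0 < θ) (T : ℕ) :
    θ * loopEntropy θ T ≤ ∑' m : ℕ, 1 / ((m : ℝ) + 1) ^ 2 := by
  have hsum : Summable fun m : ℕ => 1 / ((m : ℝ) + 1) ^ 2 := by
    have := (summable_nat_add_iff 1).mpr (Real.summable_one_div_nat_pow.mpr one_lt_two)
    simpa using this
  have hs : ∀ t : ℕ, HasSum (fun m : ℕ => Real.exp (-(θ * (t + 2))) ^ (m + 1) / ((m : ℝ) + 1))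
      (-Real.log (1 - Real.exp (-(θ * (t + 2))))) := fun t => by
    refine Real.hasSum_pow_div_log_of_abs_lt_one ?_
    rw [abs_of_pos (Real.exp_pos _), Real.exp_lt_one_iff, neg_lt_zero]
    positivity
  have hs' := (hasSum_sum (s := Finset.range T) fun t _ => hs t).mul_left θ
  refine hs'.tsum_eq.symm.trans_le ?_
  refine hs'.summable.tsum_le_tsum (fun m => ?_) hsum
  have hm : (0 : ℝ) < m + 1 := by positivity
  set x := Real.exp (-(θ * (m + 1))) with hx
  have hx1 : x < 1 := Real.exp_lt_one_iff.mpr (neg_lt_zero.mpr (by positivity))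
  have hx0 : 0 < x := Real.exp_pos _
  have hterm : ∀ t : ℕ, Real.exp (-(θ * (t + 2))) ^ (m + 1) = x * (x * x ^ t) := fun t => by
    rw [hx, ← Real.exp_nat_mul, ← Real.exp_nat_mul, ← Real.exp_add, ← Real.exp_add]
    congr 1
    push_cast
    ring
  have hgeom : ∑ t ∈ Finset.range T, x ^ t ≤ (1 - x)⁻¹ := by
    rw [← tsum_geometric_of_lt_one hx0.le hx1]
    exact (summable_geometric_of_lt_one hx0.le hx1).sum_le_tsum _ fun m _ => (pow_pos hx0 _).le
  have hx2 : x * (θ * (m + 1)) ≤ 1 - x := by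
    have h1 := Real.add_one_le_exp (θ * (m + 1))
    have h2 : x * Real.exp (θ * (m + 1)) = 1 := by rw [hx, ← Real.exp_add]; simp
    nlinarith
  simp only [hterm, ← Finset.sum_div, ← Finset.mul_sum]
  have h1x : 0 < 1 - x := sub_pos.mpr hx1
  have hS : 0 ≤ ∑ t ∈ Finset.range T, x ^ t := Finset.sum_nonneg fun t _ => (pow_pos hx0 _).le
  have hfin : θ * (m + 1) * (x * (x * ∑ t ∈ Finset.range T, x ^ t)) ≤ 1 := by
    calc θ * (m + 1) * (x * (x * ∑ t ∈ Finset.range T, x ^ t))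
        ≤ θ * (m + 1) * (x * (1 * (1 - x)⁻¹)) := by gcongr
      _ = x * (θ * (m + 1)) * (1 - x)⁻¹ := by ring
      _ ≤ (1 - x) * (1 - x)⁻¹ := by gcongr
      _ = 1 := mul_inv_cancel₀ h1x.ne'
  rw [mul_div_assoc', div_le_div_iff₀ hm (by positivity)]
  nlinarith

/-- The square of half the growth constant. -/
noncomputable def entropySup : ℝ := ⨆ x : Set.Ioi (0 : ℝ) × ℕ, (x.1 : ℝ) * loopEntropy x.1 x.2

theorem bddAbove_mul_loopEntropy :
    BddAbove (Set.range fun x : Set.Ioi (0 : ℝ) × ℕ => (x.1 : ℝ) * loopEntropy x.1 x.2) := by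
  refine ⟨∑' m : ℕ, 1 / ((m : ℝ) + 1) ^ 2, ?_⟩
  rintro _ ⟨x, rfl⟩
  exact mul_loopEntropy_le x.1.2 x.2

theorem mul_loopEntropy_le_entropySup {θ : ℝ} (hθ : 0 < θ) (T : ℕ) :
    θ * loopEntropy θ T ≤ entropySup :=
  le_ciSup bddAbove_mul_loopEntropy (⟨⟨θ, hθ⟩, T⟩ : Set.Ioi (0 : ℝ) × ℕ)

theorem exists_lt_mul_loopEntropy {z : ℝ} (hz : z < entropySup) :
    ∃ θ : ℝ, 0 < θ ∧ ∃ T : ℕ, z < θ * loopEntropy θ T := by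
  have : Nonempty (Set.Ioi (0 : ℝ) × ℕ) := ⟨⟨⟨1, Set.mem_Ioi.mpr one_pos⟩, 0⟩⟩
  obtain ⟨x, hx⟩ := exists_lt_of_lt_ciSup hz
  exact ⟨x.1, x.1.2, x.2, hx⟩

theorem entropySup_pos : 0 < entropySup := by
  refine lt_of_lt_of_le ?_ (mul_loopEntropy_le_entropySup one_pos 1)
  simp only [loopEntropy, one_mul, Finset.sum_range_one]
  exact neg_log_one_sub_exp_pos (by norm_num)

theorem L_le_mul_sqrt {h w : ℕ} (hh : 1 ≤ h) (hw : 1 ≤ w) :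
    L h w ≤ 2 * √entropySup * w * √h := by
  set Z := entropySup
  have hZ : 0 < √Z := Real.sqrt_pos.mpr entropySup_pos
  have hh' : 0 < √(h : ℝ) := Real.sqrt_pos.mpr (Nat.cast_pos.mpr hh)
  -- `β = √Z / √h` minimizes `β w h + w Z / β`; the two summands are then equal.
  have hβ : 0 < √Z / √h := div_pos hZ hh'
  refine (L_le hw hβ).trans ?_
  have h1 := sum_length_le (w := w) (G := fun u => -Real.log (1 - Real.exp (-(√Z / √h * u))))
    fun u hu => by
      have : (0 : ℝ) < u := Nat.cast_pos.mpr (by have := (Finset.mem_Icc.mp hu).1; omega)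
      exact (neg_log_one_sub_exp_pos (by positivity)).le
  have h2 : ∑ u ∈ Finset.Icc 2 w, -Real.log (1 - Real.exp (-(√Z / √h * u))) =
      loopEntropy (√Z / √h) (w - 1) := by
    rw [loopEntropy, ← Finset.Ico_succ_right_eq_Icc, Finset.sum_Ico_eq_sum_range]
    refine Finset.sum_congr (by congr 1) fun t _ => ?_
    push_cast
    rw [add_comm (2 : ℝ)]
  have h3 := mul_loopEntropy_le_entropySup hβ (w - 1)
  have h4 : loopEntropy (√Z / √h) (w - 1) ≤ √Z * √h := by
    rw [← le_div_iff₀' hβ] at h3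
    refine h3.trans_eq ?_
    change Z / (√Z / √h) = _
    rw [div_div_eq_mul_div, div_eq_iff hZ.ne', mul_right_comm,
      Real.mul_self_sqrt entropySup_pos.le]
  have h5 : √Z / √h * (w * h) = √Z * w * √h := by
    rw [div_mul_eq_mul_div, div_eq_iff hh'.ne']
    linear_combination (-√Z * w) * Real.mul_self_sqrt (Nat.cast_nonneg (α := ℝ) h)
  rw [h2] at h1
  have h6 := mul_le_mul_of_nonneg_left h4 (Nat.cast_nonneg (α := ℝ) w)
  linarith

/-! ### The regime `w ≺ √h` -/

theorem neg_log_one_sub_exp_le {y : ℝ} (hy : 0 < y) :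
    -Real.log (1 - Real.exp (-y)) ≤ y - Real.log y := by
  have h1 : y * Real.exp (-y) ≤ 1 - Real.exp (-y) := by
    have h2 : Real.exp (-y) * Real.exp y = 1 := by rw [← Real.exp_add]; simp
    nlinarith [Real.add_one_le_exp y, Real.exp_pos (-y)]
  have h3 := Real.log_le_log (by positivity) h1
  rw [Real.log_mul hy.ne' (Real.exp_ne_zero _), Real.log_exp] at h3
  linarith

/-- There are at most `w` loops of each length, and `∑ log (w / u) = w log w - log w! ≤ w`. Hence
the spread of lengths costs only `O(w²)`. -/
theorem sum_log_div_length_le (w : ℕ) :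
    ∑ p : LongLoop w, Real.log (w / p.length) ≤ (w : ℝ) ^ 2 := by
  have hnn : ∀ u ∈ Finset.Icc 1 w, 0 ≤ Real.log ((w : ℝ) / u) := fun u hu => by
    obtain ⟨h1, h2⟩ := Finset.mem_Icc.mp hu
    refine Real.log_nonneg ((one_le_div (Nat.cast_pos.mpr h1)).mpr (Nat.cast_le.mpr h2))
  have hsub : Finset.Icc 2 w ⊆ Finset.Icc 1 w := Finset.Icc_subset_Icc_left one_le_two
  refine (sum_length_le (G := fun u => Real.log ((w : ℝ) / u)) fun u hu => hnn u (hsub hu)).trans ?_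
  rw [pow_two]
  refine mul_le_mul_of_nonneg_left ((Finset.sum_le_sum_of_subset_of_nonneg hsub
    fun u hu _ => hnn u hu).trans ?_) (Nat.cast_nonneg w)
  have h1 : ∀ u ∈ Finset.Icc 1 w, Real.log ((w : ℝ) / u) = Real.log w - Real.log u :=
    fun u hu => by
      obtain ⟨h1, h2⟩ := Finset.mem_Icc.mp hu
      exact Real.log_div (Nat.cast_ne_zero.mpr (by omega)) (Nat.cast_ne_zero.mpr (by omega))
  have h2 : ∑ u ∈ Finset.Icc 1 w, Real.log (u : ℝ) = Real.log w.factorial := by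
    rw [← Finset.prod_Ico_id_eq_factorial, Nat.cast_prod, ← Order.succ_eq_add_one,
      Finset.Ico_succ_right_eq_Icc, Real.log_prod]
    exact fun u hu => Nat.cast_ne_zero.mpr (by have := (Finset.mem_Icc.mp hu).1; omega)
  rw [Finset.sum_congr rfl h1, Finset.sum_sub_distrib, h2]
  simp only [Finset.sum_const, Nat.card_Icc, Nat.add_sub_cancel, nsmul_eq_mul]
  linarith [le_log_factorial w]

theorem two_mul_card_longLoop (w : ℕ) :
    2 * (Fintype.card (LongLoop w) : ℝ) = (w : ℝ) ^ 2 - w := by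
  have h : Fintype.card (LongLoop w) * 2 + w = w ^ 2 := by
    rw [card_longLoop]
    cases w with
    | zero => rfl
    | succ w =>
      rw [Nat.add_sub_cancel]
      ring
  have h' : (Fintype.card (LongLoop w) : ℝ) * 2 + w = (w : ℝ) ^ 2 := by exact_mod_cast h
  linarith

theorem L_le_card_mul_log {h w : ℕ} (hw : 1 ≤ w) (hwh : w ^ 2 ≤ h) :
    L h w ≤ Fintype.card (LongLoop w) * Real.log (h / (w : ℝ) ^ 2) + 3 * (w : ℝ) ^ 2 := by
  have hw0 : (0 : ℝ) < w := Nat.cast_pos.mpr hw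
  have hwh' : (w : ℝ) ^ 2 ≤ h := by exact_mod_cast hwh
  have hh0 : (0 : ℝ) < h := (pow_pos hw0 2).trans_le hwh'
  -- With `β = w / h` the term `β w h` is only `w ^ 2`, and every `β * length` is at most one.
  have hβ : 0 < (w : ℝ) / h := div_pos hw0 hh0
  have hterm : ∀ p : LongLoop w, -Real.log (1 - Real.exp (-((w : ℝ) / h * p.length))) ≤
      1 + Real.log (h / (w : ℝ) ^ 2) + Real.log (w / p.length) := fun p => by
    have hl : (0 : ℝ) < p.length := Nat.cast_pos.mpr (zero_lt_two.trans_le (two_le_length p))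
    have hl' : (p.length : ℝ) ≤ w := Nat.cast_le.mpr (length_le p)
    have h1 := neg_log_one_sub_exp_le (mul_pos hβ hl)
    have h2 : (w : ℝ) / h * p.length ≤ 1 := by
      rw [div_mul_eq_mul_div, div_le_one hh0]
      nlinarith
    rw [Real.log_mul hβ.ne' hl.ne', Real.log_div hw0.ne' hh0.ne'] at h1
    rw [Real.log_div hh0.ne' (pow_pos hw0 2).ne', Real.log_pow, Real.log_div hw0.ne' hl.ne']
    push_cast
    linarith
  have hsum := Finset.sum_le_sum fun p (_ : p ∈ Finset.univ) => hterm p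
  rw [Finset.sum_add_distrib, Finset.sum_const, Finset.card_univ, nsmul_eq_mul] at hsum
  have h1 := L_le hw hβ (h := h)
  have h2 : (w : ℝ) / h * (w * h) = (w : ℝ) ^ 2 := by field_simp
  have h3 := sum_log_div_length_le w
  have h4 := two_mul_card_longLoop w
  have h5 : (0 : ℝ) ≤ Fintype.card (LongLoop w) := Nat.cast_nonneg _
  rw [h2] at h1
  linarith

theorem isEquivalent_L_of_isLittleO_sqrt {h w : ℕ → ℕ} (hh : Tendsto h atTop atTop)
    (hw : Tendsto w atTop atTop)
    (hwh : (fun n => (w n : ℝ)) =o[atTop] (fun n => √(h n : ℝ))) :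
    (fun n => L (h n) (w n)) ~[atTop]
      (fun n => (w n : ℝ) ^ 2 * Real.log (√(h n : ℝ) / (w n : ℝ))) := by
  have hw1 := hw.eventually_ge_atTop 1
  have hh1 := hh.eventually_ge_atTop 1
  have hwR : Tendsto (fun n => (w n : ℝ)) atTop atTop := tendsto_natCast_atTop_atTop.comp hw
  have hX : Tendsto (fun n => Real.log (√(h n : ℝ) / (w n : ℝ))) atTop atTop := by
    refine Real.tendsto_log_atTop.comp ?_
    have h0 := hwh.tendsto_div_nhds_zero
    have h1 : Tendsto (fun n => (w n : ℝ) / √(h n : ℝ)) atTop (nhdsWithin 0 (Set.Ioi 0)) := by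
      refine tendsto_nhdsWithin_iff.mpr ⟨h0, ?_⟩
      filter_upwards [hw1, hh1] with n h1 h2
      have : (0 : ℝ) < w n := Nat.cast_pos.mpr h1
      have : (0 : ℝ) < h n := Nat.cast_pos.mpr h2
      exact Set.mem_Ioi.mpr (by positivity)
    refine (tendsto_inv_nhdsGT_zero.comp h1).congr fun n => ?_
    simp
  refine isLittleO_iff.mpr fun ε hε => ?_
  -- With `X` the logarithm, the errors are `3 w²` and `w X`; the thresholds `6 / ε` and `2 / ε`
  -- make each at most `ε / 2` times `w² X`.
  filter_upwards [hw1, hh1, hX.eventually_ge_atTop (6 / ε), hwR.eventually_ge_atTop (2 / ε)]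
    with n h1 h2 h3 h4
  have hw0 : (0 : ℝ) < w n := Nat.cast_pos.mpr h1
  have hh0 : (0 : ℝ) < h n := Nat.cast_pos.mpr h2
  set X := Real.log (√(h n : ℝ) / (w n : ℝ)) with hXdef
  have hX0 : 0 < X := (by positivity : 0 < 6 / ε).trans_le h3
  have hlog : Real.log (h n / (w n : ℝ) ^ 2) = 2 * X := by
    rw [hXdef, Real.log_div (Real.sqrt_pos.mpr hh0).ne' hw0.ne', Real.log_sqrt hh0.le,
      Real.log_div hh0.ne' (pow_pos hw0 2).ne', Real.log_pow]
    push_cast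
    ring
  have hle : w n ^ 2 ≤ h n := by
    have h5 : 0 < Real.log (h n / (w n : ℝ) ^ 2) := by rw [hlog]; positivity
    have h6 := (Real.log_pos_iff (by positivity)).mp h5
    rw [one_lt_div (by positivity)] at h6
    exact_mod_cast h6.le
  have hup := L_le_card_mul_log h1 hle
  have hlo := card_mul_log_le_L h2 h1
  rw [hlog] at hup hlo
  have hc := two_mul_card_longLoop (w n)
  have hcX : (Fintype.card (LongLoop (w n)) : ℝ) * (2 * X) = (w n : ℝ) ^ 2 * X - w n * X := by
    linear_combination X * hc
  rw [hcX] at hup hlo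
  have h3' : 6 ≤ X * ε := (div_le_iff₀ hε).mp h3
  have h4' : 2 ≤ w n * ε := (div_le_iff₀ hε).mp h4
  have e1 : (w n : ℝ) ^ 2 * 6 ≤ (w n : ℝ) ^ 2 * (X * ε) := by gcongr
  have e2 : w n * X * 2 ≤ w n * X * (w n * ε) := by gcongr
  have e3 : 0 < w n * X := by positivity
  rw [Pi.sub_apply, Real.norm_eq_abs, Real.norm_eq_abs, abs_of_pos (by positivity : 0 < _ * X),
    abs_le]
  constructor <;> nlinarith

/-! ### The regime `w ≻ √h` -/

open Topology in
theorem eventually_mul_sqrt_le_L {h w : ℕ → ℕ} (hh : Tendsto h atTop atTop)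
    (hw : Tendsto w atTop atTop)
    (hwh : (fun n => √(h n : ℝ)) =o[atTop] (fun n => (w n : ℝ))) {K : ℝ} (hK0 : 0 < K)
    (hK : K < 2 * √entropySup) : ∀ᶠ n in atTop, K * w n * √(h n) ≤ L (h n) (w n) := by
  have hKsq : (K / 2) ^ 2 < entropySup := by
    rw [← Real.lt_sqrt (by positivity)]
    linarith
  obtain ⟨θ, hθ, T, hT⟩ := exists_lt_mul_loopEntropy hKsq
  set y : ℕ → ℝ := fun t => θ * (t + 2) with hy
  have hy0 : ∀ t, 0 < y t := fun t => by positivity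
  set μ : ℕ → ℝ := fun t => (Real.exp (y t) - 1)⁻¹ with hμ
  have hμ0 : ∀ t, 0 < μ t := fun t => inv_pos.mpr (sub_pos.mpr (Real.one_lt_exp_iff.mpr (hy0 t)))
  set A : ℝ := ∑ t ∈ Finset.range T, (t + 2) * μ t with hA
  have hTpos : 0 < T := by
    rcases T.eq_zero_or_pos with rfl | h0
    · simp only [loopEntropy, Finset.range_zero, Finset.sum_empty, mul_zero] at hT
      exact absurd hT (not_lt.mpr (by positivity))
    · exact h0
  have hA0 : 0 < A := Finset.sum_pos (fun t _ => mul_pos (by positivity) (hμ0 t))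
    ⟨0, Finset.mem_range.mpr hTpos⟩
  set H : ℕ → ℝ := fun t => y t * μ t - Real.log (1 - Real.exp (-(y t))) with hHdef
  have hH : ∑ t ∈ Finset.range T, H t = θ * A + loopEntropy θ T := by
    rw [hA, loopEntropy, Finset.mul_sum, ← Finset.sum_add_distrib]
    exact Finset.sum_congr rfl fun t _ => by simp only [hHdef, hy]; ring
  -- AM-GM: `(θ A + S)² ≥ 4 θ S A > K² A`, where `S = loopEntropy θ T`.
  have hKA : K * √A < ∑ t ∈ Finset.range T, H t := by
    rw [hH]
    have hS := loopEntropy_nonneg hθ T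
    refine lt_of_pow_lt_pow_left₀ 2 (by positivity) ?_
    rw [mul_pow, Real.sq_sqrt hA0.le]
    nlinarith [sq_nonneg (θ * A - loopEntropy θ T)]
  obtain ⟨ε, hε, hεE⟩ : ∃ ε : ℝ, 0 < ε ∧ K * √A < ∑ t ∈ Finset.range T, (H t - ε) := by
    -- Half of the gap, shared equally among the `T` terms.
    refine ⟨(∑ t ∈ Finset.range T, H t - K * √A) / (2 * T), ?_, ?_⟩
    · have : (0 : ℝ) < T := Nat.cast_pos.mpr hTpos
      exact div_pos (sub_pos.mpr hKA) (by positivity)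
    · have : (T : ℝ) ≠ 0 := Nat.cast_ne_zero.mpr hTpos.ne'
      rw [Finset.sum_sub_distrib, Finset.sum_const, Finset.card_range, nsmul_eq_mul,
        show (T : ℝ) * ((∑ t ∈ Finset.range T, H t - K * √A) / (2 * T)) =
          (∑ t ∈ Finset.range T, H t - K * √A) / 2 by field_simp]
      linarith
  set E := ∑ t ∈ Finset.range T, (H t - ε) with hE
  have hsA : 0 < √A := Real.sqrt_pos.mpr hA0
  have hE0 : 0 < E := (by positivity : 0 < K * √A).trans hεE
  have hrt : Tendsto (fun n => √(h n : ℝ) / √A) atTop atTop :=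
    (Real.tendsto_sqrt_atTop.comp (tendsto_natCast_atTop_atTop.comp hh)).atTop_div_const hsA
  -- The largest integer with `s ^ 2 * A ≤ h`, so that the block capacities `⌊s ^ 2 * μ t⌋₊` fit
  -- below height `h`.
  set s : ℕ → ℕ := fun n => ⌊√(h n : ℝ) / √A⌋₊ with hs
  have hs_top : Tendsto s atTop atTop := tendsto_nat_floor_atTop.comp hrt
  have hs_ratio : Tendsto (fun n => (s n : ℝ) / √(h n)) atTop (𝓝 (1 / √A)) := by
    have h1 := ((tendsto_nat_floor_div_atTop (R := ℝ)).comp hrt).div_const (√A)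
    refine h1.congr fun n => ?_
    simp only [Function.comp_apply, hs]
    field_simp
  have hsw : Tendsto (fun n => (s n : ℝ) / √(h n) * (√(h n) / w n)) atTop (𝓝 (1 / √A * 0)) :=
    hs_ratio.mul hwh.tendsto_div_nhds_zero
  -- The expression is `(w / s - (T + 1)) * s² * E` divided by `w √h`. The loss of `T + 1` blocks
  -- disappears in the limit because `s / w → 0`; this is where `w ≻ √h` enters.
  have hlim : Tendsto (fun n => ((s n : ℝ) / √(h n) -
      (T + 1) * ((s n : ℝ) / √(h n) * (√(h n) / w n)) * ((s n : ℝ) / √(h n))) * E) atTop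
      (𝓝 ((1 / √A - (T + 1) * (1 / √A * 0) * (1 / √A)) * E)) :=
    (hs_ratio.sub ((hsw.const_mul _).mul hs_ratio)).mul_const E
  have hKlim : K < (1 / √A - (T + 1) * (1 / √A * 0) * (1 / √A)) * E := by
    rw [mul_zero, mul_zero, zero_mul, sub_zero, one_div_mul_eq_div, lt_div_iff₀ hsA]
    exact hεE
  have hchoose : ∀ᶠ n in atTop, ∀ t ∈ Finset.range T,
      ((s n ^ 2 : ℕ) : ℝ) * (H t - ε) ≤ Real.log ((s n ^ 2 + ⌊((s n ^ 2 : ℕ) : ℝ) * μ t⌋₊).choose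
        ⌊((s n ^ 2 : ℕ) : ℝ) * μ t⌋₊) :=
    (eventually_all_finset _).mpr fun t _ =>
      ((tendsto_pow_atTop two_ne_zero).comp hs_top).eventually
        (eventually_le_log_choose (hy0 t) hε)
  filter_upwards [hchoose, hlim.eventually_const_lt hKlim, hw.eventually_ge_atTop 1,
    hh.eventually_ge_atTop 1, hs_top.eventually_ge_atTop 1] with n hc hKn hw1 hh1 hs1
  have hw0 : (0 : ℝ) < w n := Nat.cast_pos.mpr hw1
  have hh0 : (0 : ℝ) < √(h n : ℝ) := Real.sqrt_pos.mpr (Nat.cast_pos.mpr hh1)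
  have hs0 : (0 : ℝ) < s n := Nat.cast_pos.mpr hs1
  have hsA' : (s n : ℝ) ^ 2 * A ≤ h n := by
    have h1 : (s n : ℝ) * √A ≤ √(h n) :=
      (le_div_iff₀ hsA).mp (Nat.floor_le (by positivity))
    calc (s n : ℝ) ^ 2 * A = (s n * √A) ^ 2 := by rw [mul_pow, Real.sq_sqrt hA0.le]
      _ ≤ √(h n : ℝ) ^ 2 := by gcongr
      _ = h n := Real.sq_sqrt (Nat.cast_nonneg _)
  have hcap : ∑ t ∈ Finset.range T, (t + 2) * ⌊((s n ^ 2 : ℕ) : ℝ) * μ t⌋₊ ≤ h n := by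
    rw [← Nat.cast_le (α := ℝ)]
    push_cast
    refine le_trans ?_ hsA'
    rw [hA, Finset.mul_sum]
    refine Finset.sum_le_sum fun t _ => ?_
    have := Nat.floor_le (mul_nonneg (sq_nonneg (s n : ℝ)) (hμ0 t).le)
    calc ((t : ℝ) + 2) * ⌊(s n : ℝ) ^ 2 * μ t⌋₊ ≤ (t + 2) * ((s n : ℝ) ^ 2 * μ t) := by gcongr
      _ = _ := by ring
  refine le_trans ?_ (mul_sum_log_choose_le_L hw1 (s n) T _ hcap)
  have h1 := Finset.sum_le_sum hc
  rw [← Finset.mul_sum] at h1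
  refine le_trans ?_ (mul_le_mul_of_nonneg_left h1 (Nat.cast_nonneg _))
  have hdiv : (w n : ℝ) / s n - (T + 1) ≤ ((w n / s n - T : ℕ) : ℝ) := by
    have h2 : (w n : ℝ) / s n < (w n / s n : ℕ) + 1 := by
      rw [← Nat.floor_div_eq_div (K := ℝ)]
      exact Nat.lt_floor_add_one _
    have h3 : ((w n / s n : ℕ) : ℝ) ≤ ((w n / s n - T : ℕ) : ℝ) + T := by
      exact_mod_cast le_tsub_add
    linarith
  calc K * w n * √(h n) = K * (w n * √(h n)) := by ring
    _ ≤ ((s n : ℝ) / √(h n) - (T + 1) * ((s n : ℝ) / √(h n) * (√(h n) / w n)) *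
          ((s n : ℝ) / √(h n))) * E * (w n * √(h n)) := by gcongr
    _ = ((w n : ℝ) / s n - (T + 1)) * (((s n ^ 2 : ℕ) : ℝ) * E) := by
        push_cast
        field_simp
    _ ≤ _ := by gcongr

theorem isEquivalent_L_of_sqrt_isLittleO {h w : ℕ → ℕ} (hh : Tendsto h atTop atTop)
    (hw : Tendsto w atTop atTop)
    (hwh : (fun n => √(h n : ℝ)) =o[atTop] (fun n => (w n : ℝ))) :
    (fun n => L (h n) (w n)) ~[atTop]
      (fun n => 2 * √entropySup * (w n : ℝ) * √(h n : ℝ)) := by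
  have hZ : 0 < √entropySup := Real.sqrt_pos.mpr entropySup_pos
  refine isLittleO_iff.mpr fun ε hε => ?_
  -- Capping `ε` at `1 / 2` keeps the constant `K` positive.
  have hδ0 : 0 < min ε (1 / 2) := lt_min hε (by norm_num)
  have hδ1 : min ε (1 / 2) < 1 := (min_le_right _ _).trans_lt (by norm_num)
  filter_upwards [hw.eventually_ge_atTop 1, hh.eventually_ge_atTop 1,
    eventually_mul_sqrt_le_L hh hw hwh (K := (1 - min ε (1 / 2)) * (2 * √entropySup))
      (mul_pos (sub_pos.mpr hδ1) (by positivity)) (by nlinarith)] with n h1 h2 h3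
  have h4 := L_le_mul_sqrt h2 h1
  have hg : 0 ≤ 2 * √entropySup * w n * √(h n) := by positivity
  rw [Pi.sub_apply, Real.norm_eq_abs, Real.norm_eq_abs, abs_of_nonneg hg, abs_le]
  have h5 := mul_le_mul_of_nonneg_right (min_le_left ε (1 / 2)) hg
  have h6 := mul_nonneg hε.le hg
  constructor <;> nlinarith

end Tesler

theorem mainTheorem1 :
    -- `T(h, 0^{w-1})` has as many elements as there are Kostant pictures of constant height `h`
    -- on `w` vertices
    (∀ h w : ℕ, 1 ≤ h → 1 ≤ w →
      (Tesler.teslerMatrices (Tesler.firstHook h w)).ncard =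
        (Tesler.kostantPicturesOfHeight (fun _ : Fin w => (h : ℤ))).ncard) ∧
    -- the case `w ≺ √h`
    (∀ h w : ℕ → ℕ, Tendsto h atTop atTop → Tendsto w atTop atTop →
      (fun n => (w n : ℝ)) =o[atTop] (fun n => √(h n : ℝ)) →
      (fun n => Tesler.L (h n) (w n)) ~[atTop]
        (fun n => (w n : ℝ) ^ 2 * Real.log (√(h n : ℝ) / (w n : ℝ)))) ∧
    -- the case `w ≻ √h`, with one constant for all such `h` and `w`
    (∃ γ : ℝ, 0 < γ ∧ ∀ h w : ℕ → ℕ, Tendsto h atTop atTop → Tendsto w atTop atTop →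
      (fun n => √(h n : ℝ)) =o[atTop] (fun n => (w n : ℝ)) →
      (fun n => Tesler.L (h n) (w n)) ~[atTop]
        (fun n => γ * (w n : ℝ) * √(h n : ℝ))) := by
  refine ⟨fun h w _ hw => Tesler.ncard_teslerMatrices_eq hw,
    fun h w hh hw hwh => Tesler.isEquivalent_L_of_isLittleO_sqrt hh hw hwh,
    2 * √Tesler.entropySup, mul_pos two_pos (Real.sqrt_pos.mpr Tesler.entropySup_pos),
    fun h w hh hw hwh => Tesler.isEquivalent_L_of_sqrt_isLittleO hh hw hwh⟩
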